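/- Theorem 4.5 (directional unique ergodicity). For $n\ge 1$ and $0\le k\le n$ define the basic block $B_{n,k}$, a word over $\{a,b\}$, by $B_{n,0}=a$, $B_{n,n}=b$ and $B_{n,k}=B_{n-1,k}B_{n-1,k-1}$ (concatenation) for $0<k<n$. Let $\mathcal L(\zeta)$ be the set of all subwords of basic blocks, and let $\Sigma\subset\{a,b\}^{\mathbb Z}$ be the subshift of all two-sided sequences all of whose finite subwords belong to $\mathcal L(\zeta)$. For words $B,C$ let $\operatorname{freq}(B,C)$ be the number of positions $0\le i<|C|$ at which $B$ occurs in $C$ (overlapping occurrences are counted), divided by $|C|$. Let $X=\{0,1\}^{\mathbb N}$ and let $T:X\to X$ be the Pascal adic transformation: $T(0^p1^q10x')=1^q0^p01x'$ for $p,q\ge 0$ and $x'\in X$, extended bijectively to the remaining points of $X$ by $T(0^i1^\infty)=1^i0^\infty$ for $i\ge1$, $T(0^\infty)=0^\infty$ and $T(1^\infty)=1^\infty$. Let $X'\subset X$ be the countable set of eventually constant sequences, and for $x\in X\setminus X'$ let $\phi(x)\in\{a,b\}^{\mathbb Z}$ be the sequence whose $i$-th letter is $a$ if the first coordinate of $T^ix$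 is $0$ and $b$ if it is $1$. For $\alpha\in(0,1)$ let $\mu_\alpha$ be the Bernoulli measure on $X$ under which the coordinates are independent and each equals $1$ with probability $\alpha$ and $0$ with probability $1-\alpha$. Let $\nu_\alpha=\mu_\alpha\circ\phi^{-1}$, and for a word $B$ let $[B]=\{\omega\in\Sigma:\omega_0\omega_1\cdots\omega_{|B|-1}=B\}$. Then for every block $B\in\mathcal L(\zeta)$, every $\alpha\in(0,1)$, and every sequence $(k_n)$ of nonnegative integers with $k_n/n\to\alpha$ (so that $k_n\le n$, and $B_{n,k_n}$ is defined, for all large $n$), $$\lim_{n\to\infty}\operatorname{freq}(B,B_{n,k_n})=\nu_\alpha([B]).$$ -/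

import Mathlib

open MeasureTheory Filter Topology

namespace PascalAdic

/-! ### The Pascal triangle of words -/

/-- The two-letter alphabet of the subshift. -/
inductive Letter
  | a
  | b
  deriving DecidableEq

instance : MeasurableSpace Letter := ⊤

/-- The basic block `B_{n,k}` (also written `ζ_n(k)`) at the vertex `(n,k)`, `n ≥ 1`, `0 ≤ k ≤ n`:
`B_{n,0} = a`, `B_{n,n} = b` and `B_{n,k} = B_{n-1,k} B_{n-1,k-1}` for `0 < k < n`.
At pairs `(n,k)` that carry no block (`n = 0` or `k > n`) it is the empty word. -/
def basicBlock : ℕ → ℕ → List Letter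
  | 0, _ => []
  | _ + 1, 0 => [Letter.a]
  | n + 1, k + 1 => if k = n then [Letter.b] else basicBlock n (k + 1) ++ basicBlock n k

/-- The language `L(ζ)`: all subwords of the basic blocks. -/
def language : Set (List Letter) :=
  {w | ∃ n k : ℕ, 1 ≤ n ∧ k ≤ n ∧ w <:+: basicBlock n k}

/-- The number of occurrences of `B` in `C`, overlaps allowed: the number of positions
`i < |C|` such that `B` is a prefix of what remains of `C` from position `i` on. -/
def occurrences (B C : List Letter) : ℕ :=
  ((Finset.range C.length).filter (fun i => B <+: C.drop i)).card

/-- The frequency of occurrences of `B` in `C`. -/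
noncomputable def freq (B C : List Letter) : ℝ :=
  (occurrences B C : ℝ) / (C.length : ℝ)

/-- The subshift `Σ`: all two-sided sequences all of whose subwords are in the language. -/
def subshift : Set (ℤ → Letter) :=
  {ω | ∀ (i : ℤ) (N : ℕ), List.ofFn (fun j : Fin N => ω (i + (j : ℕ))) ∈ language}

/-- The cylinder set `[B]` of all `ω ∈ Σ` with `ω_0 ω_1 ⋯ ω_{|B|-1} = B`. -/
def cylinder (B : List Letter) : Set (ℤ → Letter) :=
  {ω | ω ∈ subshift ∧ List.ofFn (fun j : Fin B.length => ω (j : ℕ)) = B}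

/-! ### The Pascal adic transformation -/

/-- Infinite paths from the root of the Pascal graph, given by their successive edge labels
(`true` is the label `1`, `false` the label `0`; the first edge has index `0`). -/
abbrev Path : Type := ℕ → Bool

/-- `x = 0^p 1^q 1 0 x'` for some `x'`. -/
def Kink (x : Path) (p q : ℕ) : Prop :=
  (∀ i, i < p → x i = false) ∧ (∀ i, p ≤ i → i ≤ p + q → x i = true) ∧ x (p + q + 1) = false

/-- The path `1^q 0^p 0 1 x'`, where `x'` is what remains of `x` from index `p + q + 2` on. -/
def stepAt (p q : ℕ) (x : Path) : Path := fun i =>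
  if i < q then true else if i ≤ p + q then false else if i = p + q + 1 then true else x i

/-- Interchange of the symbols `0` and `1`. -/
def swap01 (x : Path) : Path := fun i => !x i

open Classical in
/-- The Pascal adic transformation, `T (0^p 1^q 1 0 x') = 1^q 0^p 0 1 x'`. The remaining (maximal)
paths are `0^∞`, `1^∞`, which are fixed, and `0^i 1^∞` with `i ≥ 1`, which go to `1^i 0^∞`. -/
noncomputable def adicFun (x : Path) : Path :=
  if h : ∃ p q, Kink x p q then stepAt h.choose h.choose_spec.choose x
  else if ∀ i, x i = x 0 then x else swap01 x

theorem Kink.unique {x : Path} {p q p' q' : ℕ} (h : Kink x p q) (h' : Kink x p' q') :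
    p = p' ∧ q = q' := by
  have aux : ∀ {p q p' q' : ℕ}, Kink x p q → Kink x p' q' → p ≤ p' := by
    intro p q p' q' h h'
    by_contra hlt
    have h1 := h.1 p' (by omega)
    rw [h'.2.1 p' le_rfl (by omega)] at h1
    exact Bool.noConfusion h1
  have hp : p = p' := le_antisymm (aux h h') (aux h' h)
  subst hp
  have aux2 : ∀ {q q' : ℕ}, Kink x p q → Kink x p q' → q ≤ q' := by
    intro q q' h h'
    by_contra hlt
    have h1 := h.2.1 (p + q' + 1) (by omega) (by omega)
    rw [h'.2.2] at h1
    exact Bool.noConfusion h1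
  exact ⟨rfl, le_antisymm (aux2 h h') (aux2 h' h)⟩

theorem adicFun_of_kink {x : Path} {p q : ℕ} (h : Kink x p q) : adicFun x = stepAt p q x := by
  have hx : ∃ p q, Kink x p q := ⟨p, q, h⟩
  obtain ⟨h1, h2⟩ := Kink.unique h hx.choose_spec.choose_spec
  rw [adicFun, dif_pos hx]
  exact congrArg₂ (fun p q => stepAt p q x) h1.symm h2.symm

theorem swap01_swap01 (x : Path) : swap01 (swap01 x) = x := by
  funext i
  simp [swap01]

theorem kink_swap01_stepAt {x : Path} {p q : ℕ} : Kink (swap01 (stepAt p q x)) q p := by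
  refine ⟨fun i hi => ?_, fun i h1 h2 => ?_, ?_⟩
  · simp [swap01, stepAt, hi]
  · have h3 : ¬ i < q := by omega
    have h4 : i ≤ p + q := by omega
    simp [swap01, stepAt, h3, h4]
  · have h3 : ¬ q + p + 1 < q := by omega
    have h4 : ¬ q + p + 1 ≤ p + q := by omega
    have h5 : q + p + 1 = p + q + 1 := by omega
    rw [h5] at h3 h4 ⊢
    simp [swap01, stepAt, h3]

theorem stepAt_swap01_stepAt {x : Path} {p q : ℕ} (h : Kink x p q) :
    stepAt q p (swap01 (stepAt p q x)) = swap01 x := by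
  funext i
  simp only [stepAt, swap01]
  by_cases h1 : i < p
  · simp [h1, h.1 i h1]
  by_cases h2 : i ≤ p + q
  · have h2' : i ≤ q + p := by omega
    simp [h1, h2', h.2.1 i (by omega) h2]
  have h2' : ¬ i ≤ q + p := by omega
  by_cases h3 : i = p + q + 1
  · have h3' : i = q + p + 1 := by omega
    rw [if_neg h1, if_neg h2', if_pos h3', h3, h.2.2]
    rfl
  have h3' : ¬ i = q + p + 1 := by omega
  have h4 : ¬ i < q := by omega
  simp [h1, h2, h2', h3, h3', h4]

/-- `S T S T = S`, with `S` the interchange of symbols. -/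
theorem adicFun_swap01_adicFun (x : Path) : adicFun (swap01 (adicFun x)) = swap01 x := by
  classical
  by_cases h : ∃ p q, Kink x p q
  · obtain ⟨p, q, hk⟩ := h
    rw [adicFun_of_kink hk, adicFun_of_kink kink_swap01_stepAt, stepAt_swap01_stepAt hk]
  · have hx : adicFun x = if ∀ i, x i = x 0 then x else swap01 x := by
      rw [adicFun, dif_neg h]
    by_cases hc : ∀ i, x i = x 0
    · rw [hx, if_pos hc]
      have hk : ¬ ∃ p q, Kink (swap01 x) p q := by
        rintro ⟨p, q, -, h1, h2⟩
        have h3 := h1 p le_rfl (by omega)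
        simp only [swap01] at h2 h3
        rw [hc] at h2 h3
        rw [h2] at h3
        exact Bool.noConfusion h3
      have hc' : ∀ i, swap01 x i = swap01 x 0 := by
        intro i
        simp only [swap01]
        rw [hc i]
      rw [adicFun, dif_neg hk, if_pos hc']
    · rw [hx, if_neg hc, swap01_swap01, hx, if_neg hc]

/-- The Pascal adic transformation as a bijection of the path space. -/
noncomputable def adic : Equiv.Perm Path where
  toFun := adicFun
  invFun := fun x => swap01 (adicFun (swap01 x))
  left_inv := fun x => by
    change swap01 (adicFun (swap01 (adicFun x))) = x
    rw [adicFun_swap01_adicFun, swap01_swap01]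
  right_inv := fun x => by
    change adicFun (swap01 (adicFun (swap01 x))) = x
    rw [adicFun_swap01_adicFun, swap01_swap01]

/-! ### The coding and the measures -/

/-- The countable set `X'` of eventually diagonal paths. -/
def eventuallyDiagonal : Set Path :=
  {x | ∃ n : ℕ, (∀ k, n ≤ k → x k = false) ∨ (∀ k, n ≤ k → x k = true)}

/-- An edge labelled `0` is coded by `a`, an edge labelled `1` by `b`. -/
def letterOf : Bool → Letter
  | false => Letter.a
  | true => Letter.b

/-- The coding map `φ`: the letter `φ(x)_i` is the code of the first edge of `T^i x`. -/
noncomputable def coding (x : Path) : ℤ → Letter :=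
  fun i => letterOf ((adic ^ i) x 0)

/-- The Bernoulli measure `μ_α` on the path space, under which the edge labels are independent
and each of them is `1` with probability `α` and `0` with probability `1 - α`. -/
noncomputable def mu (α : unitInterval) : Measure Path :=
  Measure.infinitePi (fun _ : ℕ => ProbabilityTheory.bernoulliMeasure true false α)

/-- The measure `ν_α = μ_α ∘ φ⁻¹`, the image of `μ_α` under `φ : X \ X' → Σ`. -/
noncomputable def nu (α : unitInterval) : Measure (ℤ → Letter) :=
  Measure.map coding ((mu α).restrict eventuallyDiagonalᶜ)

theorem measurableSet_kink (p q : ℕ) : MeasurableSet {x : Path | Kink x p q} := by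
  have hm : ∀ (i : ℕ) (c : Bool), MeasurableSet {x : Path | x i = c} := fun i c =>
    measurable_pi_apply (X := fun _ : ℕ => Bool) i (measurableSet_singleton c)
  refine MeasurableSet.inter ?_ (MeasurableSet.inter ?_ (hm _ _))
  · change MeasurableSet {x : Path | ∀ i, i < p → x i = false}
    simp only [Set.ofPred_forall]
    exact MeasurableSet.iInter fun i => MeasurableSet.iInter fun _ => hm i _
  · change MeasurableSet {x : Path | ∀ i, p ≤ i → i ≤ p + q → x i = true}
    simp only [Set.ofPred_forall]
    exact MeasurableSet.iInter fun i => MeasurableSet.iInter fun _ =>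
      MeasurableSet.iInter fun _ => hm i _

theorem measurable_swap01 : Measurable swap01 :=
  measurable_pi_lambda _ fun i =>
    (measurable_of_countable not).comp (measurable_pi_apply (X := fun _ : ℕ => Bool) i)

theorem measurable_stepAt (p q : ℕ) : Measurable (stepAt p q) := by
  refine measurable_pi_lambda _ fun i => ?_
  unfold stepAt
  split_ifs
  · exact measurable_const
  · exact measurable_const
  · exact measurable_const
  · exact measurable_pi_apply (X := fun _ : ℕ => Bool) i

theorem measurable_adicFun : Measurable adicFun := by
  classical
  intro s hs
  have hK : MeasurableSet {x : Path | ∃ p q, Kink x p q} := by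
    simp only [Set.ofPred_exists]
    exact MeasurableSet.iUnion fun p => MeasurableSet.iUnion fun q => measurableSet_kink p q
  have hC : MeasurableSet {x : Path | ∀ i, x i = x 0} := by
    simp only [Set.ofPred_forall]
    exact MeasurableSet.iInter fun i =>
      measurableSet_eq_fun (measurable_pi_apply (X := fun _ : ℕ => Bool) i)
        (measurable_pi_apply (X := fun _ : ℕ => Bool) 0)
  have heq : adicFun ⁻¹' s =
      (⋃ p, ⋃ q, {x : Path | Kink x p q} ∩ stepAt p q ⁻¹' s) ∪
        ({x : Path | ∃ p q, Kink x p q}ᶜ ∩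
          (({x : Path | ∀ i, x i = x 0} ∩ s) ∪ ({x : Path | ∀ i, x i = x 0}ᶜ ∩ swap01 ⁻¹' s))) := by
    ext x
    by_cases h : ∃ p q, Kink x p q
    · obtain ⟨p, q, hk⟩ := h
      have hx : ∃ p q, Kink x p q := ⟨p, q, hk⟩
      simp only [Set.mem_preimage, Set.mem_union, Set.mem_iUnion, Set.mem_inter_iff,
        Set.mem_ofPred_eq, Set.mem_compl_iff, hx, not_true_eq_false, false_and, or_false]
      constructor
      · intro h
        exact ⟨p, q, hk, by rwa [← adicFun_of_kink hk]⟩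
      · rintro ⟨p', q', hk', h⟩
        rwa [adicFun_of_kink hk']
    · have hx : ∀ p q, ¬ Kink x p q := fun p q hk => h ⟨p, q, hk⟩
      have hT : adicFun x = if ∀ i, x i = x 0 then x else swap01 x := by
        rw [adicFun, dif_neg h]
      simp only [Set.mem_preimage, Set.mem_union, Set.mem_iUnion, Set.mem_inter_iff,
        Set.mem_ofPred_eq, Set.mem_compl_iff, hx, hT, false_and, exists_false, false_or,
        not_false_eq_true, true_and]
      by_cases hc : ∀ i, x i = x 0
      · simp only [hc, if_true, implies_true, true_and, not_true_eq_false, false_and, or_false]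
      · simp only [hc, if_false, false_and, not_false_eq_true, true_and, false_or]
  rw [heq]
  refine MeasurableSet.union ?_ (hK.compl.inter ((hC.inter hs).union
    (hC.compl.inter (measurable_swap01 hs))))
  exact MeasurableSet.iUnion fun p => MeasurableSet.iUnion fun q =>
    (measurableSet_kink p q).inter (measurable_stepAt p q hs)

/-- The coding map is Borel measurable, so that `nu` is a genuine image measure. -/
theorem measurable_coding : Measurable coding := by
  have hT : Measurable (adic : Path → Path) := measurable_adicFun
  have hS : Measurable ((adic⁻¹ : Equiv.Perm Path) : Path → Path) :=
    measurable_swap01.comp (measurable_adicFun.comp measurable_swap01)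
  have hpow : ∀ (f : Equiv.Perm Path), Measurable (f : Path → Path) →
      ∀ n : ℕ, Measurable ((f ^ n : Equiv.Perm Path) : Path → Path) := by
    intro f hf n
    rw [Equiv.Perm.coe_pow]
    exact hf.iterate n
  have hz : ∀ i : ℤ, Measurable ((adic ^ i : Equiv.Perm Path) : Path → Path) := by
    intro i
    obtain ⟨n, rfl | rfl⟩ := Int.eq_nat_or_neg i
    · rw [zpow_natCast]
      exact hpow _ hT n
    · rw [zpow_neg, zpow_natCast, ← inv_pow]
      exact hpow _ hS n
  exact measurable_pi_lambda _ fun i =>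
    (measurable_of_countable letterOf).comp
      ((measurable_pi_apply (X := fun _ : ℕ => Bool) 0).comp (hz i))

end PascalAdic

/-!
The word `B_{n,k}` is the concatenation, over the paths from level `m` to the vertex `(n, k)`, of
the blocks `B_{m,j}` at which these paths start, and `B_{m,j}` is used `(n - m).choose (k - j)`
times. Occurrences of `B` add up over the constituents, except that up to `|B|` more appear at each
junction (`le_occurrences_append`, `occurrences_append_le`). Hence the frequency of `B` in `B_{n,k}`
lies between the sums over `j` of `(n - m).choose (k - j) / n.choose k` times the number of
occurrences of `B` in `B_{m,j}`, and times that number increased by `|B|` (`freq_bounds`). If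
`k / n → α`, the coefficient tends to `α ^ j * (1 - α) ^ (m - j)` (`tendsto_choose_ratio`).

The measure of the cylinder of `B` lies between the limits of these two sums. Indeed an initial
segment of length `m` of a path `x` with `j` labels `1` has a position `rank m x` in the block
`B_{m,j}`, each position belongs to exactly one such segment, of Bernoulli measure
`α ^ j * (1 - α) ^ (m - j)`, and the adic transformation moves a path to the next position
(`ones_rank_adic`). So the coding of `x` starts with the letters of `B_{m,j}` from that position on,
and whether it starts with `B` is decided by the block unless `x` is at one of its last `|B|`
positions (`sum_occurrences_le_nu`, `nu_le_sum_occurrences_add`).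

The two bounds differ by `|B|` times the sum of `α ^ j * (1 - α) ^ (m - j)` over `j ≤ m`, which has
only `m + 1` terms, each at most `max α (1 - α) ^ m`, and so tends to zero with growing `m`
(`tendsto_sum_weights_zero`). No ergodic theorem is needed.
-/

namespace PascalAdic

/-! ### Words and basic blocks -/

theorem basicBlock_eq_nil : ∀ {n k : ℕ}, n < k → basicBlock n k = []
  | 0, _, _ => by simp [basicBlock]
  | n + 1, k + 1, h => by
    rw [basicBlock, if_neg (by omega), basicBlock_eq_nil (by omega : n < k + 1),
      basicBlock_eq_nil (by omega : n < k), List.append_nil]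

theorem basicBlock_zero {n : ℕ} (hn : 1 ≤ n) : basicBlock n 0 = [Letter.a] := by
  obtain ⟨n, rfl⟩ := Nat.exists_eq_add_of_le' hn
  rfl

theorem basicBlock_self {n : ℕ} (hn : 1 ≤ n) : basicBlock n n = [Letter.b] := by
  obtain ⟨n, rfl⟩ := Nat.exists_eq_add_of_le' hn
  simp [basicBlock]

/-- Off the root, the concatenation rule also holds on the right side `k = n` of the triangle and
beyond it, because the blocks outside the triangle are empty. -/
theorem basicBlock_succ_succ {n : ℕ} (hn : 1 ≤ n) (k : ℕ) :
    basicBlock (n + 1) (k + 1) = basicBlock n (k + 1) ++ basicBlock n k := by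
  rw [basicBlock]
  split_ifs with h
  · subst h
    rw [basicBlock_eq_nil (Nat.lt_succ_self k), basicBlock_self hn, List.nil_append]
  · rfl

theorem length_basicBlock {n : ℕ} (hn : 1 ≤ n) : ∀ k, (basicBlock n k).length = n.choose k := by
  induction n, hn using Nat.le_induction with
  | base =>
    intro k
    rcases k with _ | _ | k
    · simp [basicBlock]
    · simp [basicBlock]
    · rw [basicBlock_eq_nil (by omega), Nat.choose_eq_zero_of_lt (by omega), List.length_nil]
  | succ n hn ih =>
    intro k
    rcases k with _ | k
    · simp [basicBlock]
    · rw [basicBlock_succ_succ hn, List.length_append, ih, ih, Nat.choose_succ_succ, add_comm]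

theorem occurrences_nil (B : List Letter) : occurrences B [] = 0 := by
  simp [occurrences]

theorem occurrences_cons (B : List Letter) (c : Letter) (C : List Letter) :
    occurrences B (c :: C) = (if B <+: c :: C then 1 else 0) + occurrences B C := by
  simp only [occurrences, Finset.card_filter, List.length_cons, Finset.sum_range_succ']
  simp [add_comm]

theorem le_occurrences_append (B A C : List Letter) :
    occurrences B A + occurrences B C ≤ occurrences B (A ++ C) := by
  induction A with
  | nil => simp [occurrences_nil]
  | cons c A ih =>
    rw [List.cons_append, occurrences_cons, occurrences_cons]
    have : (if B <+: c :: A then 1 else 0) ≤ (if B <+: c :: (A ++ C) then 1 else 0 : ℕ) := by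
      split_ifs with h h'
      · rfl
      · exact absurd (h.trans (List.prefix_append (c :: A) C)) h'
      · exact Nat.zero_le _
      · rfl
    omega

/-- An occurrence of `B` in `A ++ C` that lies neither in `A` nor in `C` starts at one of the last
`|B|` positions of `A`. -/
theorem occurrences_append_le (B A C : List Letter) :
    occurrences B (A ++ C) ≤ occurrences B A + occurrences B C + min B.length A.length := by
  induction A with
  | nil => simp [occurrences_nil]
  | cons c A ih =>
    rw [List.cons_append, occurrences_cons, occurrences_cons, List.length_cons]
    by_cases hl : B.length ≤ A.length
    · have : (if B <+: c :: (A ++ C) then 1 else 0) ≤ (if B <+: c :: A then 1 else 0 : ℕ) := by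
        split_ifs with h h'
        · rfl
        · exact absurd (List.prefix_of_prefix_length_le h (List.prefix_append (c :: A) C)
            (by simp; omega)) h'
        · exact Nat.zero_le _
        · rfl
      omega
    · have : (if B <+: c :: (A ++ C) then 1 else 0 : ℕ) ≤ 1 := by split_ifs <;> simp
      omega

/-- The number of occurrences of `B` in `B_{n,k}`, increased by `|B|` unless the block is empty.
The increment pays for the occurrences across one junction, which makes this count subadditive
along the concatenation rule. -/
def paddedOccurrences (B : List Letter) (n k : ℕ) : ℕ :=
  occurrences B (basicBlock n k) + if k ≤ n then B.length else 0

theorem occurrences_basicBlock_succ_succ_ge (B : List Letter) {n : ℕ} (hn : 1 ≤ n) (k : ℕ) :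
    occurrences B (basicBlock n (k + 1)) + occurrences B (basicBlock n k) ≤
      occurrences B (basicBlock (n + 1) (k + 1)) := by
  rw [basicBlock_succ_succ hn]
  exact le_occurrences_append _ _ _

theorem paddedOccurrences_succ_succ_le (B : List Letter) {n : ℕ} (hn : 1 ≤ n) (k : ℕ) :
    paddedOccurrences B (n + 1) (k + 1) ≤
      paddedOccurrences B n (k + 1) + paddedOccurrences B n k := by
  unfold paddedOccurrences
  rcases lt_trichotomy k n with h | rfl | h
  · rw [basicBlock_succ_succ hn, if_pos (by omega), if_pos (by omega), if_pos (by omega)]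
    have := occurrences_append_le B (basicBlock n (k + 1)) (basicBlock n k)
    omega
  · rw [basicBlock_self (by omega), basicBlock_self hn, if_pos le_rfl, if_pos le_rfl]
    omega
  · rw [basicBlock_eq_nil (by omega : n + 1 < k + 1), if_neg (by omega), occurrences_nil]
    exact Nat.zero_le _

theorem occurrences_le_paddedOccurrences (B : List Letter) (n k : ℕ) :
    occurrences B (basicBlock n k) ≤ paddedOccurrences B n k :=
  Nat.le_add_right _ _

/-- A subsolution of Pascal's recursion dominates the solution with the same values at level `m`.
The solution is a sum over the vertices `(m, k - i)` that lead to `(m + r, k)`, weighted by the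
number of paths between the two vertices. -/
theorem sum_choose_mul_le {f : ℕ → ℕ → ℕ} {m : ℕ}
    (h0 : ∀ n, m ≤ n → f n 0 ≤ f (n + 1) 0)
    (hs : ∀ n, m ≤ n → ∀ k, f n (k + 1) + f n k ≤ f (n + 1) (k + 1)) (r : ℕ) :
    ∀ k, ∑ p ∈ Finset.HasAntidiagonal.antidiagonal k, r.choose p.1 * f m p.2 ≤ f (m + r) k := by
  induction r with
  | zero =>
    intro k
    rcases k with _ | k <;> simp [Finset.Nat.sum_antidiagonal_succ]
  | succ r ih =>
    intro k
    rcases k with _ | k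
    · rw [← add_assoc m r 1]
      simpa using (by simpa using ih 0 : f m 0 ≤ f (m + r) 0).trans (h0 (m + r) (by omega))
    · rw [Finset.Nat.sum_antidiagonal_succ]
      have h1 := ih (k + 1)
      rw [Finset.Nat.sum_antidiagonal_succ] at h1
      have h2 := hs (m + r) (by omega) k
      have h3 := ih k
      simp only [Nat.choose_succ_succ', add_mul, Finset.sum_add_distrib, Nat.choose_zero_right]
        at h1 ⊢
      rw [← add_assoc m r 1]
      omega

/-- The counterpart of `sum_choose_mul_le` for a supersolution. -/
theorem le_sum_choose_mul {f : ℕ → ℕ → ℕ} {m : ℕ}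
    (h0 : ∀ n, m ≤ n → f (n + 1) 0 ≤ f n 0)
    (hs : ∀ n, m ≤ n → ∀ k, f (n + 1) (k + 1) ≤ f n (k + 1) + f n k) (r : ℕ) :
    ∀ k, f (m + r) k ≤ ∑ p ∈ Finset.HasAntidiagonal.antidiagonal k, r.choose p.1 * f m p.2 := by
  induction r with
  | zero =>
    intro k
    rcases k with _ | k <;> simp [Finset.Nat.sum_antidiagonal_succ]
  | succ r ih =>
    intro k
    rcases k with _ | k
    · rw [← add_assoc m r 1]
      simpa using (h0 (m + r) (by omega)).trans (by simpa using ih 0 : f (m + r) 0 ≤ f m 0)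
    · rw [Finset.Nat.sum_antidiagonal_succ]
      have h1 := ih (k + 1)
      rw [Finset.Nat.sum_antidiagonal_succ] at h1
      have h2 := hs (m + r) (by omega) k
      have h3 := ih k
      simp only [Nat.choose_succ_succ', add_mul, Finset.sum_add_distrib, Nat.choose_zero_right]
        at h1 ⊢
      rw [← add_assoc m r 1]
      omega

/-- The terms of index above the level vanish, so an antidiagonal sum is a sum over the level. -/
theorem sum_antidiagonal_eq_sum_range {g : ℕ → ℕ} {m k : ℕ} (hmk : m ≤ k)
    (hg : ∀ j, m < j → g j = 0) (r : ℕ) :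
    ∑ p ∈ Finset.HasAntidiagonal.antidiagonal k, r.choose p.1 * g p.2 =
      ∑ j ∈ Finset.range (m + 1), r.choose (k - j) * g j := by
  rw [← Finset.Nat.sum_antidiagonal_swap, Finset.Nat.sum_antidiagonal_eq_sum_range_succ_mk]
  refine (Finset.sum_subset (Finset.range_subset_range.2 (by omega)) fun j _ hj => ?_).symm
  simp only [Finset.mem_range, not_lt] at hj
  simp [hg j (by omega)]

theorem sum_occurrences_le (B : List Letter) {m n k : ℕ} (hm : 1 ≤ m) (hn : m ≤ n) (hk : m ≤ k) :
    ∑ j ∈ Finset.range (m + 1), (n - m).choose (k - j) * occurrences B (basicBlock m j) ≤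
      occurrences B (basicBlock n k) := by
  rw [← sum_antidiagonal_eq_sum_range hk
    (fun j hj => by rw [basicBlock_eq_nil hj, occurrences_nil])]
  have := sum_choose_mul_le (f := fun n k => occurrences B (basicBlock n k)) (m := m)
    (fun n hn => by simp only [basicBlock_zero (hm.trans hn), basicBlock_zero (Nat.le_add_left 1 n),
      le_refl])
    (fun n hn k => occurrences_basicBlock_succ_succ_ge B (hm.trans hn) k) (n - m) k
  rwa [Nat.add_sub_cancel' hn] at this

theorem occurrences_le_sum (B : List Letter) {m n k : ℕ} (hm : 1 ≤ m) (hn : m ≤ n) (hk : m ≤ k) :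
    occurrences B (basicBlock n k) ≤
      ∑ j ∈ Finset.range (m + 1),
        (n - m).choose (k - j) * (occurrences B (basicBlock m j) + B.length) := by
  have h := le_sum_choose_mul (f := paddedOccurrences B) (m := m)
    (fun n hn => by simp only [paddedOccurrences, basicBlock_zero (hm.trans hn),
      basicBlock_zero (Nat.le_add_left 1 n), Nat.zero_le, le_refl])
    (fun n hn k => paddedOccurrences_succ_succ_le B (hm.trans hn) k) (n - m) k
  rw [Nat.add_sub_cancel' hn, sum_antidiagonal_eq_sum_range hk
    (fun j hj => by rw [paddedOccurrences, basicBlock_eq_nil hj, occurrences_nil,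
      if_neg (by omega)])] at h
  refine (occurrences_le_paddedOccurrences B n k).trans (h.trans (le_of_eq ?_))
  refine Finset.sum_congr rfl fun j hj => ?_
  rw [paddedOccurrences, if_pos (by simpa [Nat.lt_succ_iff] using hj)]

/-! ### Ratios of binomial coefficients -/

theorem choose_pred_ratio {n k : ℕ} (h : k ≤ n) :
    ((n.choose k : ℕ) : ℝ) = (n + 1).choose k * ((n + 1 - k : ℝ) / (n + 1)) := by
  have h1 := Nat.choose_mul_succ_eq n k
  have h2 : ((n.choose k : ℕ) : ℝ) * (n + 1) = (n + 1).choose k * (n + 1 - k) := by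
    have : (((n.choose k) * (n + 1) : ℕ) : ℝ) = (((n + 1).choose k * (n + 1 - k) : ℕ) : ℝ) := by
      rw [h1]
    push_cast [Nat.cast_sub (by omega : k ≤ n + 1)] at this
    exact this
  have : (n + 1 : ℝ) ≠ 0 := by positivity
  field_simp
  linarith

theorem choose_pred_pred_ratio (n k : ℕ) :
    ((n.choose k : ℕ) : ℝ) = (n + 1).choose (k + 1) * ((k + 1 : ℝ) / (n + 1)) := by
  have h1 : ((n + 1 : ℕ) : ℝ) * n.choose k = (n + 1).choose (k + 1) * (k + 1 : ℕ) := by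
    exact_mod_cast Nat.add_one_mul_choose_eq n k
  push_cast at h1
  have : (n + 1 : ℝ) ≠ 0 := by positivity
  field_simp
  linarith

theorem eventually_le_of_tendsto_div {α : ℝ} (hα : 0 < α) {k : ℕ → ℕ}
    (hk : Tendsto (fun n : ℕ => (k n : ℝ) / (n : ℝ)) atTop (𝓝 α)) (j : ℕ) :
    ∀ᶠ n in atTop, j ≤ k n := by
  have h0 : Tendsto (fun n : ℕ => (j : ℝ) / (n : ℝ)) atTop (𝓝 0) :=
    tendsto_const_nhds.div_atTop tendsto_natCast_atTop_atTop
  have h1 := (hk.sub h0).eventually (lt_mem_nhds (by simpa using hα : 0 < α - 0))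
  filter_upwards [h1, eventually_gt_atTop 0] with n hn hn0
  have hn0' : (0 : ℝ) < n := by exact_mod_cast hn0
  rw [← sub_div, div_pos_iff_of_pos_right hn0', sub_pos] at hn
  exact_mod_cast hn.le

/-- The proportion of the paths to `(n, k n)` that extend a given path from the root to
`(m, j)` tends to the Bernoulli weight of the latter. -/
theorem tendsto_choose_ratio {α : ℝ} (hα : α ∈ Set.Ioo (0 : ℝ) 1) {k : ℕ → ℕ}
    (hk : Tendsto (fun n : ℕ => (k n : ℝ) / (n : ℝ)) atTop (𝓝 α)) (m : ℕ) :
    ∀ j ≤ m, Tendsto (fun n : ℕ => ((n - m).choose (k n - j) : ℝ) / (n.choose (k n) : ℝ)) atTop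
      (𝓝 (α ^ j * (1 - α) ^ (m - j))) := by
  have hcn : ∀ c : ℝ, Tendsto (fun n : ℕ => c / (n : ℝ)) atTop (𝓝 0) := fun c =>
    tendsto_const_nhds.div_atTop tendsto_natCast_atTop_atTop
  have hkbig : ∀ j : ℕ, ∀ᶠ n in atTop, j + 1 ≤ k n := fun j =>
    eventually_le_of_tendsto_div hα.1 hk (j + 1)
  have hksmall : ∀ j : ℕ, ∀ᶠ n in atTop, k n + j + 1 ≤ n := by
    intro j
    have h1 := (hk.add (hcn (j + 1))).eventually (gt_mem_nhds (by simpa using hα.2 : α + 0 < 1))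
    filter_upwards [h1, eventually_gt_atTop 0] with n hn hn0
    have hn0' : (0 : ℝ) < n := by exact_mod_cast hn0
    rw [← add_div, div_lt_one hn0'] at hn
    have : ((k n + j + 1 : ℕ) : ℝ) < n := by push_cast; linarith
    exact_mod_cast this.le
  have hratio : ∀ (m j : ℕ), Tendsto (fun n : ℕ => ((k n : ℝ) - j) / (n - m)) atTop (𝓝 α) := by
    intro m j
    have h1 : Tendsto (fun n : ℕ => ((k n : ℝ) / n - (j : ℝ) / n) / (1 - (m : ℝ) / n)) atTop
        (𝓝 α) := by
      have h := (hk.sub (hcn j)).div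
        ((tendsto_const_nhds (x := (1 : ℝ))).sub (hcn m)) (by norm_num)
      rwa [sub_zero, sub_zero, div_one] at h
    refine h1.congr' ?_
    filter_upwards [eventually_gt_atTop m] with n hn
    have hn0' : (0 : ℝ) < n := by exact_mod_cast (by omega : 0 < n)
    rw [← sub_div, ← div_self hn0'.ne', ← sub_div, div_div_div_cancel_right₀ hn0'.ne']
  induction m with
  | zero =>
    intro j hj
    obtain rfl : j = 0 := by omega
    refine (tendsto_congr' (f₂ := fun _ => (1 : ℝ)) ?_).2 (by simp)
    filter_upwards [hksmall 0] with n hn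
    have : (n.choose (k n) : ℝ) ≠ 0 := by exact_mod_cast (Nat.choose_pos (by omega)).ne'
    simp [this]
  | succ m ih =>
    intro j hj
    rcases Nat.lt_or_ge m j with hmj | hmj
    -- on the right side of the triangle the last edge is labelled `1`
    · obtain rfl : j = m + 1 := by omega
      have h := (ih m le_rfl).mul (hratio m m)
      rw [Nat.sub_self, pow_zero, mul_one, ← pow_succ] at h
      rw [Nat.sub_self, pow_zero, mul_one]
      refine h.congr' ?_
      filter_upwards [hkbig m, hksmall m] with n h1 h2
      have e1 : n - m = (n - (m + 1)) + 1 := by omega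
      have e2 : k n - m = (k n - (m + 1)) + 1 := by omega
      rw [choose_pred_pred_ratio (n - (m + 1)) (k n - (m + 1)), ← e1, ← e2,
        Nat.cast_sub (by omega : m + 1 ≤ n), Nat.cast_sub (by omega : m + 1 ≤ k n)]
      push_cast
      ring_nf
    -- otherwise the ratio is reached through an edge labelled `0`
    · have h := (ih j hmj).mul ((tendsto_const_nhds (x := (1 : ℝ))).sub (hratio m j))
      rw [mul_assoc, ← pow_succ, ← Nat.sub_add_comm hmj] at h
      refine h.congr' ?_
      filter_upwards [hkbig m, hksmall m] with n h1 h2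
      have e1 : n - m = (n - (m + 1)) + 1 := by omega
      rw [choose_pred_ratio (by omega : k n - j ≤ n - (m + 1)), ← e1,
        Nat.cast_sub (by omega : m + 1 ≤ n), Nat.cast_sub (by omega : j ≤ k n)]
      have : (n - m : ℝ) ≠ 0 := by
        have : (m : ℝ) < n := by exact_mod_cast (by omega : m < n)
        linarith
      push_cast
      rw [show (n - (m + 1) + 1 : ℝ) = n - m by ring, mul_div_right_comm]
      congr 1
      field_simp

/-! ### Positions of paths in the blocks -/

/-- The number of labels `1` among the first `m` edges of `x`; the path passes through the vertex
`(m, ones m x)`. -/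
def ones : ℕ → Path → ℕ
  | 0, _ => 0
  | m + 1, x => ones m x + (x m).toNat

/-- The number of paths from the root to `(m, ones m x)` that precede the initial segment of `x` in
the adic order. A last edge labelled `1` comes after all the paths whose last edge is labelled `0`,
and these are counted by a binomial coefficient. -/
def rank : ℕ → Path → ℕ
  | 0, _ => 0
  | m + 1, x => rank m x + if x m then m.choose (ones m x + 1) else 0

theorem ones_succ_false {m : ℕ} {x : Path} (h : x m = false) : ones (m + 1) x = ones m x := by
  simp [ones, h]

theorem ones_succ_true {m : ℕ} {x : Path} (h : x m = true) : ones (m + 1) x = ones m x + 1 := by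
  simp [ones, h]

theorem rank_succ_false {m : ℕ} {x : Path} (h : x m = false) : rank (m + 1) x = rank m x := by
  simp [rank, h]

theorem rank_succ_true {m : ℕ} {x : Path} (h : x m = true) :
    rank (m + 1) x = rank m x + m.choose (ones m x + 1) := by
  simp [rank, h]

theorem ones_le (m : ℕ) (x : Path) : ones m x ≤ m := by
  induction m with
  | zero => rfl
  | succ m ih =>
    cases h : x m
    · rw [ones_succ_false h]; omega
    · rw [ones_succ_true h]; omega

theorem rank_lt_choose (m : ℕ) (x : Path) : rank m x < m.choose (ones m x) := by
  induction m with
  | zero => simp [rank, ones]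
  | succ m ih =>
    cases h : x m
    · rw [ones_succ_false h, rank_succ_false h]
      exact ih.trans_le (Nat.choose_le_succ m _)
    · rw [ones_succ_true h, rank_succ_true h, Nat.choose_succ_succ]
      simp only [Nat.succ_eq_add_one]
      omega

theorem eq_false_of_ones_eq_zero {m : ℕ} {x : Path} (h : ones m x = 0) :
    ∀ i < m, x i = false := by
  induction m with
  | zero => intro i hi; omega
  | succ m ih =>
    intro i hi
    cases hm : x m
    · rw [ones_succ_false hm] at h
      rcases Nat.lt_succ_iff_lt_or_eq.1 hi with h' | rfl
      · exact ih h i h'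
      · exact hm
    · rw [ones_succ_true hm] at h
      omega

/-- The last path to `(m, k)` is `0^{m-k} 1^k`. -/
theorem eq_of_rank_add_one_eq {m : ℕ} {x : Path} (h : rank m x + 1 = m.choose (ones m x)) :
    ∀ i < m, x i = decide (m - ones m x ≤ i) := by
  induction m with
  | zero => intro i hi; omega
  | succ m ih =>
    intro i hi
    have hlt := rank_lt_choose m x
    cases hm : x m
    · rw [ones_succ_false hm] at h ⊢
      rw [rank_succ_false hm] at h
      have h0 : ones m x = 0 := by
        by_contra h0
        obtain ⟨k, hk⟩ := Nat.exists_eq_succ_of_ne_zero h0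
        have h2 : 0 < m.choose k := Nat.choose_pos (by have := ones_le m x; omega)
        rw [hk] at h hlt
        rw [Nat.choose_succ_succ] at h
        simp only [Nat.succ_eq_add_one] at *
        omega
      have hf : x i = false :=
        eq_false_of_ones_eq_zero (m := m + 1) (by rw [ones_succ_false hm, h0]) i hi
      rw [hf]
      simp only [false_eq_decide_iff]
      omega
    · rw [ones_succ_true hm] at h ⊢
      rw [rank_succ_true hm, Nat.choose_succ_succ, Nat.succ_eq_add_one] at h
      have ho := ones_le m x
      rcases Nat.lt_succ_iff_lt_or_eq.1 hi with h' | rfl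
      · rw [ih (by omega) i h']
        congr 2
        omega
      · rw [hm]
        simp

/-- The first path to `(m, k)` is `1^k 0^{m-k}`. -/
theorem ones_rank_of_eq {m k : ℕ} {x : Path} (hk : k ≤ m) (h : ∀ i < m, x i = decide (i < k)) :
    ones m x = k ∧ rank m x = 0 := by
  induction m generalizing k with
  | zero => simp [ones, rank]; omega
  | succ m ih =>
    rcases Nat.lt_or_ge m k with hmk | hmk
    · obtain rfl : k = m + 1 := by omega
      have hm : x m = true := by simp [h m (by omega)]
      obtain ⟨h1, h2⟩ := ih le_rfl fun i hi => by
        rw [h i (by omega)]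
        simp [hi, hi.trans (Nat.lt_succ_self m)]
      rw [ones_succ_true hm, rank_succ_true hm, h1, h2]
      simp
    · have hm : x m = false := by simp [h m (by omega), hmk]
      obtain ⟨h1, h2⟩ := ih hmk fun i hi => h i (by omega)
      rw [ones_succ_false hm, rank_succ_false hm]
      exact ⟨h1, h2⟩

/-- The adic transformation moves a path to the next position of its block, as long as it does not
leave the block; the change takes place within the first `m` edges. -/
theorem exists_kink_rank_step {m : ℕ} {x : Path} (h : rank m x + 1 < m.choose (ones m x)) :
    ∃ p q, Kink x p q ∧ p + q + 1 < m ∧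
      ones m (stepAt p q x) = ones m x ∧ rank m (stepAt p q x) = rank m x + 1 := by
  induction m with
  | zero => simp [rank, ones] at h
  | succ m ih =>
    have hlt := rank_lt_choose m x
    have hstep : ∀ {p q}, p + q + 1 < m → stepAt p q x m = x m := fun {p q} hpq => by
      simp only [stepAt]
      rw [if_neg (by omega), if_neg (by omega), if_neg (by omega)]
    cases hm : x m
    · rw [ones_succ_false hm] at h ⊢
      rw [rank_succ_false hm] at h ⊢
      by_cases hlast : rank m x + 1 = m.choose (ones m x)
      -- the initial segment of length `m` is the last one, and the kink ends with the edge `m`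
      · have hform := eq_of_rank_add_one_eq hlast
        have ho := ones_le m x
        have hpos : 1 ≤ ones m x := by
          by_contra h0
          rw [show ones m x = 0 by omega] at h
          simp at h
        have hKink : Kink x (m - ones m x) (ones m x - 1) := by
          refine ⟨fun i hi => ?_, fun i h1 h2 => ?_, ?_⟩
          · rw [hform i (by omega)]
            simp only [decide_eq_false_iff_not]
            omega
          · rw [hform i (by omega)]
            simp only [decide_eq_true_eq]
            omega
          · rw [show m - ones m x + (ones m x - 1) + 1 = m by omega, hm]
        refine ⟨_, _, hKink, by omega, ?_⟩
        obtain ⟨h1, h2⟩ := ones_rank_of_eq (m := m) (k := ones m x - 1)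
          (x := stepAt (m - ones m x) (ones m x - 1) x) (by omega) fun i hi => by
            by_cases h1 : i < ones m x - 1
            · simp [stepAt, h1]
            · simp only [stepAt, h1, if_false, decide_false]
              rw [if_pos (by omega)]
        have h3 : stepAt (m - ones m x) (ones m x - 1) x m = true := by
          simp only [stepAt]
          rw [if_neg (by omega), if_neg (by omega), if_pos (by omega)]
        rw [ones_succ_true h3, rank_succ_true h3, h1, h2, Nat.sub_add_cancel hpos]
        exact ⟨rfl, by omega⟩
      · obtain ⟨p, q, hK, hpq, h1, h2⟩ := ih (by omega)
        have h3 := (hstep hpq).trans hm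
        exact ⟨p, q, hK, by omega, by rw [ones_succ_false h3, h1], by rw [rank_succ_false h3, h2]⟩
    · rw [ones_succ_true hm] at h ⊢
      rw [rank_succ_true hm] at h ⊢
      rw [Nat.choose_succ_succ, Nat.succ_eq_add_one] at h
      obtain ⟨p, q, hK, hpq, h1, h2⟩ := ih (by omega)
      have h3 := (hstep hpq).trans hm
      refine ⟨p, q, hK, by omega, by rw [ones_succ_true h3, h1], ?_⟩
      rw [rank_succ_true h3, h1, h2]
      omega

theorem ones_rank_adic {m : ℕ} {x : Path} (h : rank m x + 1 < m.choose (ones m x)) :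
    ones m (adic x) = ones m x ∧ rank m (adic x) = rank m x + 1 := by
  obtain ⟨p, q, hK, -, h1, h2⟩ := exists_kink_rank_step h
  have : adic x = stepAt p q x := adicFun_of_kink hK
  rw [this]
  exact ⟨h1, h2⟩

theorem ones_rank_adic_pow {m : ℕ} {x : Path} (i : ℕ) (h : rank m x + i < m.choose (ones m x)) :
    ones m ((adic ^ i) x) = ones m x ∧ rank m ((adic ^ i) x) = rank m x + i := by
  induction i with
  | zero => simp
  | succ i ih =>
    obtain ⟨h1, h2⟩ := ih (by omega)
    have h3 := ones_rank_adic (m := m) (x := (adic ^ i) x) (by rw [h1, h2]; omega)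
    rw [pow_succ', Equiv.Perm.mul_apply, h3.1, h3.2, h1, h2]
    exact ⟨rfl, by omega⟩

/-- The blocks list the first letters of the paths in the adic order. -/
theorem getElem?_basicBlock_rank {m : ℕ} (hm : 1 ≤ m) (x : Path) :
    (basicBlock m (ones m x))[rank m x]? = some (letterOf (x 0)) := by
  induction m, hm using Nat.le_induction with
  | base => cases h : x 0 <;> simp [ones, rank, h, basicBlock, letterOf]
  | succ m hm ih =>
    have hlt := rank_lt_choose m x
    cases h : x m
    · rw [ones_succ_false h, rank_succ_false h]
      rcases hk : ones m x with _ | k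
      · rw [hk] at ih
        rwa [basicBlock_zero (by omega), ← basicBlock_zero hm]
      · rw [hk] at ih hlt
        rwa [basicBlock_succ_succ hm,
          List.getElem?_append_left (by rwa [length_basicBlock hm])]
    · rw [ones_succ_true h, rank_succ_true h, basicBlock_succ_succ hm,
        List.getElem?_append_right (by rw [length_basicBlock hm]; omega), length_basicBlock hm,
        Nat.add_sub_cancel]
      exact ih

/-- The first `N` letters of the coding of a path can be read off in its block of level `m`, from
its position on, when the block is long enough. -/
theorem ofFn_coding_eq_take_drop {m : ℕ} (hm : 1 ≤ m) {x : Path} {N : ℕ}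
    (h : rank m x + N ≤ m.choose (ones m x)) :
    List.ofFn (fun j : Fin N => coding x ((j : ℕ) : ℤ)) =
      ((basicBlock m (ones m x)).drop (rank m x)).take N := by
  apply List.ext_getElem?
  intro i
  by_cases hi : i < N
  · obtain ⟨h1, h2⟩ := ones_rank_adic_pow (m := m) (x := x) i (by omega)
    have h3 := getElem?_basicBlock_rank hm ((adic ^ i) x)
    rw [h1, h2] at h3
    rw [List.getElem?_take_of_lt hi, List.getElem?_drop, h3, List.getElem?_ofFn, dif_pos hi]
    simp [coding]
  · rw [List.getElem?_eq_none (by simpa using hi),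
      List.getElem?_eq_none (by rw [List.length_take]; omega)]

/-! ### The coding takes values in the subshift -/

theorem exists_eq_of_notMem_eventuallyDiagonal {x : Path} (hx : x ∉ eventuallyDiagonal)
    (n : ℕ) (c : Bool) :
    ∃ k, n ≤ k ∧ x k = c := by
  by_contra! h
  refine hx ⟨n, ?_⟩
  cases c
  · exact Or.inr fun k hk => by simpa using h k hk
  · exact Or.inl fun k hk => by simpa using h k hk

theorem exists_kink {x : Path} (hx : x ∉ eventuallyDiagonal) : ∃ p q, Kink x p q := by
  classical
  have h1 : ∃ p, x p = true := by
    obtain ⟨k, -, hk⟩ := exists_eq_of_notMem_eventuallyDiagonal hx 0 true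
    exact ⟨k, hk⟩
  have h2 : ∃ q, x (Nat.find h1 + q + 1) = false := by
    obtain ⟨k, hk, hk'⟩ := exists_eq_of_notMem_eventuallyDiagonal hx (Nat.find h1 + 1) false
    exact ⟨k - Nat.find h1 - 1, by rwa [show Nat.find h1 + (k - Nat.find h1 - 1) + 1 = k by omega]⟩
  refine ⟨Nat.find h1, Nat.find h2, fun i hi => ?_, fun i hi hi' => ?_, Nat.find_spec h2⟩
  · simpa using Nat.find_min h1 hi
  · rcases hi.eq_or_lt with rfl | hlt
    · exact Nat.find_spec h1
    · have := Nat.find_min h2 (m := i - Nat.find h1 - 1) (by omega)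
      rw [show Nat.find h1 + (i - Nat.find h1 - 1) + 1 = i by omega] at this
      simpa using this

theorem eventuallyDiagonal_of_eventually_eq {x y : Path} {n : ℕ} (h : ∀ k, n ≤ k → x k = y k)
    (hy : y ∈ eventuallyDiagonal) : x ∈ eventuallyDiagonal := by
  obtain ⟨m, hm⟩ := hy
  refine ⟨max n m, hm.imp (fun h' k hk => ?_) (fun h' k hk => ?_)⟩ <;>
  · rw [h k (le_of_max_le_left hk), h' k (le_of_max_le_right hk)]

theorem adic_notMem_eventuallyDiagonal {x : Path} (hx : x ∉ eventuallyDiagonal) :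
    adic x ∉ eventuallyDiagonal := by
  obtain ⟨p, q, hK⟩ := exists_kink hx
  have : adic x = stepAt p q x := adicFun_of_kink hK
  rw [this]
  refine fun h => hx (eventuallyDiagonal_of_eventually_eq (n := p + q + 2) (fun k hk => ?_) h)
  simp only [stepAt]
  rw [if_neg (by omega), if_neg (by omega), if_neg (by omega)]

theorem swap01_notMem_eventuallyDiagonal {x : Path} (hx : x ∉ eventuallyDiagonal) :
    swap01 x ∉ eventuallyDiagonal := by
  rintro ⟨n, h⟩
  refine hx ⟨n, h.symm.imp (fun h k hk => ?_) (fun h k hk => ?_)⟩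
  · simpa [swap01] using h k hk
  · simpa [swap01] using h k hk

theorem adic_zpow_notMem_eventuallyDiagonal {x : Path} (hx : x ∉ eventuallyDiagonal) (i : ℤ) :
    (adic ^ i) x ∉ eventuallyDiagonal := by
  induction i using Int.induction_on with
  | zero => simpa
  | succ i ih =>
    rw [add_comm, zpow_add, zpow_one, Equiv.Perm.mul_apply]
    exact adic_notMem_eventuallyDiagonal ih
  | pred i ih =>
    rw [sub_eq_neg_add, zpow_add, zpow_neg_one, Equiv.Perm.mul_apply]
    exact swap01_notMem_eventuallyDiagonal
      (adic_notMem_eventuallyDiagonal (swap01_notMem_eventuallyDiagonal ih))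

/-- The number of positions that follow a path in its block grows without bound with the level:
it never decreases, and it increases at each edge labelled `0` after the first label `1`. -/
theorem exists_rank_add_le {x : Path} (hx : x ∉ eventuallyDiagonal) (N : ℕ) :
    ∃ m, 1 ≤ m ∧ 1 ≤ ones m x ∧ rank m x + N ≤ m.choose (ones m x) := by
  have hstep : ∀ m N, 1 ≤ ones m x → rank m x + N ≤ m.choose (ones m x) →
      1 ≤ ones (m + 1) x ∧
        rank (m + 1) x + (N + if x m then 0 else 1) ≤ (m + 1).choose (ones (m + 1) x) := by
    intro m N h1 h2
    cases h : x m
    · rw [ones_succ_false h, rank_succ_false h]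
      obtain ⟨k, hk⟩ := Nat.exists_eq_add_of_le' h1
      rw [hk] at h2 ⊢
      have h3 : 0 < m.choose k := Nat.choose_pos (by have := ones_le m x; omega)
      rw [Nat.choose_succ_succ, Nat.succ_eq_add_one]
      simp only [Bool.false_eq_true, if_false]
      omega
    · rw [ones_succ_true h, rank_succ_true h, Nat.choose_succ_succ, Nat.succ_eq_add_one]
      simp only [if_true]
      omega
  have hmono : ∀ m N, 1 ≤ ones m x → rank m x + N ≤ m.choose (ones m x) → ∀ d,
      1 ≤ ones (m + d) x ∧ rank (m + d) x + N ≤ (m + d).choose (ones (m + d) x) := by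
    intro m N h1 h2 d
    induction d with
    | zero => exact ⟨h1, h2⟩
    | succ d ih =>
      have := hstep (m + d) N ih.1 ih.2
      exact ⟨this.1, by rw [← add_assoc]; omega⟩
  induction N with
  | zero =>
    obtain ⟨k, -, hk⟩ := exists_eq_of_notMem_eventuallyDiagonal hx 0 true
    exact ⟨k + 1, by omega, by rw [ones_succ_true hk]; omega, (rank_lt_choose _ _).le⟩
  | succ N ih =>
    obtain ⟨m, h0, h1, h2⟩ := ih
    obtain ⟨k, hk, hk'⟩ := exists_eq_of_notMem_eventuallyDiagonal hx m false
    obtain ⟨d, rfl⟩ := Nat.exists_eq_add_of_le hk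
    obtain ⟨h3, h4⟩ := hmono m N h1 h2 d
    have h5 := hstep _ _ h3 h4
    rw [hk'] at h5
    exact ⟨m + d + 1, by omega, h5.1, by simpa using h5.2⟩

theorem coding_zpow (x : Path) (i j : ℤ) : coding ((adic ^ i) x) j = coding x (i + j) := by
  rw [coding, coding, add_comm, zpow_add, Equiv.Perm.mul_apply]

theorem coding_mem_subshift {x : Path} (hx : x ∉ eventuallyDiagonal) : coding x ∈ subshift := by
  intro i N
  obtain ⟨m, hm, -, h⟩ := exists_rank_add_le (adic_zpow_notMem_eventuallyDiagonal hx i) N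
  refine ⟨m, ones m ((adic ^ i) x), hm, ones_le _ _, ?_⟩
  have := ofFn_coding_eq_take_drop hm h
  simp only [coding_zpow] at this
  rw [this]
  exact (List.take_prefix _ _).isInfix.trans (List.drop_suffix _ _).isInfix

/-! ### Bernoulli measures of sets of paths -/

instance (α : unitInterval) : IsProbabilityMeasure (mu α) := by
  unfold mu
  infer_instance

theorem setOf_eq_pi (s : Finset ℕ) (w : Path) :
    {x : Path | ∀ i ∈ s, x i = w i} = Set.pi (s : Set ℕ) fun i => {w i} := by
  ext x
  simp [Set.mem_pi]

theorem mu_real_setOf_eq (α : unitInterval) (s : Finset ℕ) (w : Path) :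
    (mu α).real {x : Path | ∀ i ∈ s, x i = w i} =
      ∏ i ∈ s, if w i then (α : ℝ) else 1 - (α : ℝ) := by
  rw [setOf_eq_pi, measureReal_def, mu,
    Measure.infinitePi_pi _ fun i _ => measurableSet_singleton (w i), ENNReal.toReal_prod]
  refine Finset.prod_congr rfl fun i _ => ?_
  rw [← measureReal_def]
  cases h : w i
  · exact ProbabilityTheory.bernoulliMeasure_real_apply_of_notMem_of_mem α
      (measurableSet_singleton false) (by simp) (by simp)
  · exact ProbabilityTheory.bernoulliMeasure_real_apply_of_mem_of_notMem α
      (measurableSet_singleton true) (by simp) (by simp)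

theorem ones_congr {m : ℕ} {x y : Path} (h : ∀ i < m, x i = y i) : ones m x = ones m y := by
  induction m with
  | zero => rfl
  | succ m ih => rw [ones, ones, ih fun i hi => h i (by omega), h m (by omega)]

theorem prod_range_weight (m : ℕ) (w : Path) (a b : ℝ) :
    ∏ i ∈ Finset.range m, (if w i then a else b) = a ^ ones m w * b ^ (m - ones m w) := by
  induction m with
  | zero => simp [ones]
  | succ m ih =>
    rw [Finset.prod_range_succ, ih]
    have := ones_le m w
    cases h : w m
    · rw [ones_succ_false h, Nat.sub_add_comm this, pow_succ]
      simp [mul_assoc]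
    · rw [ones_succ_true h, Nat.add_sub_add_right, pow_succ]
      simp only [if_true]
      ring

/-- The set of the paths whose initial segment of length `m` stands at position `r` of the block
`B_{m,k}`. -/
def positionSet (m k r : ℕ) : Set Path :=
  {x | ones m x = k ∧ rank m x = r}

/-- Each position of the block `B_{m,k}` belongs to exactly one initial segment of length `m`. -/
theorem exists_positionSet_eq {m k r : ℕ} (hr : r < m.choose k) :
    ∃ w : Path, ones m w = k ∧ positionSet m k r = {x | ∀ i ∈ Finset.range m, x i = w i} := by
  have hext : ∀ (m k r : ℕ) (w : Path) (c : Bool), ones m w = k →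
      positionSet m k r = {x | ∀ i ∈ Finset.range m, x i = w i} → ∃ w' : Path,
        ones (m + 1) w' = k + c.toNat ∧
        {x | x m = c ∧ x ∈ positionSet m k r} =
          {x | ∀ i ∈ Finset.range (m + 1), x i = w' i} := by
    intro m k r w c hw hset
    have hlow : ∀ i < m, Function.update w m c i = w i := fun i hi =>
      Function.update_of_ne hi.ne _ _
    refine ⟨Function.update w m c, ?_, ?_⟩
    · rw [ones, ones_congr hlow, hw, Function.update_self]
    · rw [hset]
      ext x
      simp only [Finset.mem_range, Set.mem_ofPred_eq]
      constructor
      · rintro ⟨h1, h2⟩ i hi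
        rcases Nat.lt_succ_iff_lt_or_eq.1 hi with h | rfl
        · rw [h2 i h, hlow i h]
        · rw [h1, Function.update_self]
      · intro h
        refine ⟨by rw [h m (by omega), Function.update_self], fun i hi => ?_⟩
        rw [h i (by omega), hlow i hi]
  induction m generalizing k r with
  | zero =>
    have hk : k = 0 := by
      by_contra hk
      rw [Nat.choose_eq_zero_of_lt (Nat.pos_of_ne_zero hk)] at hr
      omega
    subst hk
    have hr0 : r = 0 := by simpa using hr
    subst hr0
    exact ⟨fun _ => false, rfl, by simp [positionSet, ones, rank]⟩
  | succ m ih =>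
    by_cases hlt : r < m.choose k
    · obtain ⟨w, hw, hset⟩ := ih hlt
      obtain ⟨w', hw', hset'⟩ := hext m k r w false hw hset
      refine ⟨w', by simpa using hw', ?_⟩
      rw [← hset']
      ext x
      simp only [positionSet, Set.mem_ofPred_eq]
      cases h : x m
      · simp [ones_succ_false h, rank_succ_false h]
      · rw [ones_succ_true h, rank_succ_true h]
        simp only [Bool.true_eq_false, false_and, iff_false, not_and]
        rintro rfl
        omega
    · rcases k with _ | k
      · simp at hr hlt
        omega
      · rw [Nat.choose_succ_succ'] at hr
        obtain ⟨w, hw, hset⟩ := ih (k := k) (r := r - m.choose (k + 1)) (by omega)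
        obtain ⟨w', hw', hset'⟩ := hext m k _ w true hw hset
        refine ⟨w', by simpa using hw', ?_⟩
        rw [← hset']
        ext x
        simp only [positionSet, Set.mem_ofPred_eq]
        cases h : x m
        · rw [ones_succ_false h, rank_succ_false h]
          simp only [Bool.false_eq_true, false_and, iff_false, not_and]
          intro h1
          have := rank_lt_choose m x
          rw [h1] at this
          omega
        · rw [ones_succ_true h, rank_succ_true h]
          simp only [true_and, Nat.add_right_cancel_iff]
          constructor
          · rintro ⟨rfl, h2⟩
            exact ⟨rfl, by omega⟩
          · rintro ⟨rfl, h2⟩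
            exact ⟨rfl, by omega⟩

theorem measurableSet_positionSet {m k r : ℕ} (hr : r < m.choose k) :
    MeasurableSet (positionSet m k r) := by
  obtain ⟨w, -, h⟩ := exists_positionSet_eq hr
  rw [h, setOf_eq_pi]
  exact MeasurableSet.pi (Finset.countable_toSet _) fun i _ => measurableSet_singleton _

theorem mu_real_positionSet (α : unitInterval) {m k r : ℕ} (hr : r < m.choose k) :
    (mu α).real (positionSet m k r) = (α : ℝ) ^ k * (1 - (α : ℝ)) ^ (m - k) := by
  obtain ⟨w, hw, h⟩ := exists_positionSet_eq hr
  rw [h, mu_real_setOf_eq, prod_range_weight, hw]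

theorem mu_eventuallyDiagonal (α : unitInterval) (hα : (α : ℝ) ∈ Set.Ioo (0 : ℝ) 1) :
    mu α eventuallyDiagonal = 0 := by
  have key : ∀ (n : ℕ) (c : Bool), mu α {x : Path | ∀ k, n ≤ k → x k = c} = 0 := by
    intro n c
    rw [← measureReal_eq_zero_iff]
    refine le_antisymm ?_ measureReal_nonneg
    have hle : ∀ M : ℕ, (mu α).real {x : Path | ∀ k, n ≤ k → x k = c} ≤
        (if c then (α : ℝ) else 1 - (α : ℝ)) ^ M := by
      intro M
      refine (measureReal_mono (s₂ := {x : Path | ∀ i ∈ Finset.Ico n (n + M),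
        x i = (fun _ => c : Path) i}) fun x (hx : ∀ k, n ≤ k → x k = c) i hi =>
          hx i (Finset.mem_Ico.1 hi).1).trans_eq ?_
      rw [mu_real_setOf_eq, Finset.prod_const, Nat.card_Ico, Nat.add_sub_cancel_left]
    refine ge_of_tendsto' (tendsto_pow_atTop_nhds_zero_of_lt_one ?_ ?_) hle
    · cases c <;> simp [hα.1.le, hα.2.le]
    · cases c <;> simp [hα.1, hα.2]
  refine measure_mono_null (t := ⋃ n : ℕ, ⋃ c : Bool, {x : Path | ∀ k, n ≤ k → x k = c}) ?_ ?_
  · rintro x ⟨n, h | h⟩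
    · exact Set.mem_iUnion.2 ⟨n, Set.mem_iUnion.2 ⟨false, h⟩⟩
    · exact Set.mem_iUnion.2 ⟨n, Set.mem_iUnion.2 ⟨true, h⟩⟩
  · simp only [measure_iUnion_null_iff]
    exact fun n c => key n c

/-! ### The measure of a cylinder -/

instance : DiscreteMeasurableSpace Letter := ⟨fun _ => trivial⟩

instance : Finite Letter :=
  Finite.of_injective (fun l : Letter => decide (l = Letter.a)) fun l l' h => by
    cases l <;> cases l' <;> simp_all

theorem measurableSet_ofFn_mem (i : ℤ) (N : ℕ) (S : Set (List Letter)) :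
    MeasurableSet {ω : ℤ → Letter | List.ofFn (fun j : Fin N => ω (i + (j : ℕ))) ∈ S} := by
  have hm : Measurable fun (ω : ℤ → Letter) (j : Fin N) => ω (i + (j : ℕ)) :=
    measurable_pi_lambda _ fun j => measurable_pi_apply _
  exact hm (Set.toFinite {v : Fin N → Letter | List.ofFn v ∈ S}).measurableSet

theorem measurableSet_cylinder (B : List Letter) : MeasurableSet (cylinder B) := by
  refine MeasurableSet.inter ?_ ?_
  · change MeasurableSet {ω : ℤ → Letter | ∀ (i : ℤ) (N : ℕ),
      List.ofFn (fun j : Fin N => ω (i + (j : ℕ))) ∈ language}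
    simp only [Set.ofPred_forall]
    exact MeasurableSet.iInter fun i => MeasurableSet.iInter fun N =>
      measurableSet_ofFn_mem i N language
  · have h := measurableSet_ofFn_mem 0 B.length {B}
    simp only [zero_add] at h
    exact h

theorem nu_real_cylinder (α : unitInterval) (hα : (α : ℝ) ∈ Set.Ioo (0 : ℝ) 1)
    (B : List Letter) : (nu α).real (cylinder B) = (mu α).real (coding ⁻¹' cylinder B) := by
  have hae : ∀ᵐ x ∂mu α, x ∈ eventuallyDiagonalᶜ :=
    compl_mem_ae_iff.2 (mu_eventuallyDiagonal α hα)
  rw [nu, Measure.restrict_eq_self_of_ae_mem hae,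
    map_measureReal_apply measurable_coding (measurableSet_cylinder B)]

theorem coding_mem_cylinder_of_prefix {B : List Letter} {m k r : ℕ} (hm : 1 ≤ m)
    (hr : r < m.choose k) {x : Path} (hx : x ∉ eventuallyDiagonal) (hxr : x ∈ positionSet m k r)
    (h : B <+: (basicBlock m k).drop r) : coding x ∈ cylinder B := by
  obtain ⟨rfl, rfl⟩ := hxr
  have hlen := h.length_le
  rw [List.length_drop, length_basicBlock hm] at hlen
  refine ⟨coding_mem_subshift hx, ?_⟩
  rw [ofFn_coding_eq_take_drop hm (by omega)]
  exact (List.prefix_iff_eq_take.1 h).symm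

theorem prefix_of_coding_mem_cylinder {B : List Letter} {m k r : ℕ} (hm : 1 ≤ m)
    (hr : r + B.length ≤ m.choose k) {x : Path} (hxr : x ∈ positionSet m k r)
    (h : coding x ∈ cylinder B) : B <+: (basicBlock m k).drop r := by
  obtain ⟨rfl, rfl⟩ := hxr
  have h2 := h.2
  rw [ofFn_coding_eq_take_drop hm hr] at h2
  exact List.prefix_iff_eq_take.2 h2.symm

theorem mu_real_eq_sum_positionSet (α : unitInterval) (m : ℕ) {A : Set Path}
    (hA : MeasurableSet A) :
    (mu α).real A = ∑ k ∈ Finset.range (m + 1), ∑ r ∈ Finset.range (m.choose k),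
      (mu α).real (A ∩ positionSet m k r) := by
  rw [Finset.sum_sigma', ← measureReal_biUnion_finset]
  · congr 1
    ext x
    simp only [Set.mem_iUnion, Finset.mem_sigma, Finset.mem_range, exists_prop, Set.mem_inter_iff]
    constructor
    · intro hx
      exact ⟨⟨ones m x, rank m x⟩, ⟨by have := ones_le m x; simp only; omega,
        rank_lt_choose m x⟩, hx, rfl, rfl⟩
    · rintro ⟨-, -, hx, -⟩
      exact hx
  · rintro ⟨k, r⟩ - ⟨k', r'⟩ - hne
    refine Set.disjoint_left.2 ?_
    rintro x ⟨-, h1, h2⟩ ⟨-, h3, h4⟩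
    simp only at h1 h2 h3 h4
    exact hne (by rw [← h1, ← h2, ← h3, ← h4])
  · rintro ⟨k, r⟩ h
    exact hA.inter (measurableSet_positionSet (by simpa using (Finset.mem_sigma.1 h).2))

theorem sum_occurrences_le_nu (α : unitInterval) (hα : (α : ℝ) ∈ Set.Ioo (0 : ℝ) 1)
    (B : List Letter) {m : ℕ} (hm : 1 ≤ m) :
    ∑ k ∈ Finset.range (m + 1), (α : ℝ) ^ k * (1 - (α : ℝ)) ^ (m - k) *
      (occurrences B (basicBlock m k) : ℝ) ≤ (nu α).real (cylinder B) := by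
  rw [nu_real_cylinder α hα, mu_real_eq_sum_positionSet α m
    (measurable_coding (measurableSet_cylinder B))]
  refine Finset.sum_le_sum fun k _ => ?_
  rw [occurrences, length_basicBlock hm, mul_comm, ← nsmul_eq_mul, ← Finset.sum_const]
  refine le_trans (Finset.sum_le_sum fun r hr => ?_)
    (Finset.sum_le_sum_of_subset_of_nonneg (Finset.filter_subset _ _)
      fun _ _ _ => measureReal_nonneg)
  obtain ⟨hr, hB⟩ := Finset.mem_filter.1 hr
  have hr := Finset.mem_range.1 hr
  rw [← mu_real_positionSet α hr]
  refine (measureReal_congr ?_).le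
  filter_upwards [compl_mem_ae_iff.2 (mu_eventuallyDiagonal α hα)] with x hx
  refine propext ⟨fun h => ⟨coding_mem_cylinder_of_prefix hm hr hx h hB, h⟩, fun h => h.2⟩

/-- Only the paths at one of the last `|B|` positions of their block of level `m` can lie over the
cylinder of `B` without `B` occurring at their position of the block. -/
theorem nu_le_sum_occurrences_add (α : unitInterval) (hα : (α : ℝ) ∈ Set.Ioo (0 : ℝ) 1)
    (B : List Letter) {m : ℕ} (hm : 1 ≤ m) :
    (nu α).real (cylinder B) ≤ ∑ k ∈ Finset.range (m + 1),
      (α : ℝ) ^ k * (1 - (α : ℝ)) ^ (m - k) *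
        ((occurrences B (basicBlock m k) : ℝ) + B.length) := by
  rw [nu_real_cylinder α hα, mu_real_eq_sum_positionSet α m
    (measurable_coding (measurableSet_cylinder B))]
  refine Finset.sum_le_sum fun k _ => ?_
  have hw : 0 ≤ (α : ℝ) ^ k * (1 - (α : ℝ)) ^ (m - k) :=
    mul_nonneg (pow_nonneg hα.1.le _) (pow_nonneg (by linarith [hα.2]) _)
  rw [occurrences, length_basicBlock hm]
  set w := (α : ℝ) ^ k * (1 - (α : ℝ)) ^ (m - k) with hwdef
  have hterm : ∀ r ∈ Finset.range (m.choose k),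
      (mu α).real (coding ⁻¹' cylinder B ∩ positionSet m k r) ≤
        (if B <+: (basicBlock m k).drop r then w else 0) +
          if m.choose k < r + B.length then w else 0 := by
    intro r hr
    have hr := Finset.mem_range.1 hr
    have hle : (mu α).real (coding ⁻¹' cylinder B ∩ positionSet m k r) ≤ w := by
      rw [hwdef, ← mu_real_positionSet α hr]
      exact measureReal_mono Set.inter_subset_right
    by_cases h1 : B <+: (basicBlock m k).drop r
    · rw [if_pos h1]
      refine hle.trans (le_add_of_nonneg_right ?_)
      split_ifs <;> simp [hw]
    by_cases h2 : m.choose k < r + B.length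
    · rwa [if_neg h1, if_pos h2, zero_add]
    · rw [if_neg h1, if_neg h2, zero_add]
      refine le_of_eq ?_
      convert measureReal_empty (μ := mu α)
      exact Set.eq_empty_of_forall_notMem fun x hx =>
        h1 (prefix_of_coding_mem_cylinder hm (by omega) hx.2 hx.1)
  refine (Finset.sum_le_sum hterm).trans ?_
  rw [Finset.sum_add_distrib, ← Finset.sum_filter, ← Finset.sum_filter, Finset.sum_const,
    Finset.sum_const, nsmul_eq_mul, nsmul_eq_mul, ← add_mul, mul_comm]
  refine mul_le_mul_of_nonneg_left ?_ hw
  have hcard : ((Finset.range (m.choose k)).filter fun r => m.choose k < r + B.length).card ≤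
      B.length := by
    refine (Finset.card_le_card (t := Finset.Ico (m.choose k - B.length) (m.choose k))
      fun r hr => ?_).trans (by rw [Nat.card_Ico]; omega)
    simp only [Finset.mem_filter, Finset.mem_range, Finset.mem_Ico] at hr ⊢
    omega
  gcongr

/-! ### Convergence of the frequencies -/

/-- The number of blocks of level `m` in a long block is negligible in comparison with its length
when `m` is large: the expected reciprocal length of a block of level `m` tends to zero. -/
theorem tendsto_sum_weights_zero {a : ℝ} (ha : a ∈ Set.Ioo (0 : ℝ) 1) :
    Tendsto (fun m : ℕ => ∑ j ∈ Finset.range (m + 1), a ^ j * (1 - a) ^ (m - j)) atTop (𝓝 0) := by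
  set M := max a (1 - a) with hM
  have hM0 : 0 ≤ M := ha.1.le.trans (le_max_left _ _)
  have hM1 : M < 1 := max_lt ha.2 (by linarith [ha.1])
  have hlim : Tendsto (fun m : ℕ => (m : ℝ) * M ^ m + M ^ m) atTop (𝓝 0) := by
    simpa using (tendsto_self_mul_const_pow_of_lt_one hM0 hM1).add
      (tendsto_pow_atTop_nhds_zero_of_lt_one hM0 hM1)
  have h1 : 0 ≤ 1 - a := by linarith [ha.2]
  refine tendsto_of_tendsto_of_tendsto_of_le_of_le tendsto_const_nhds hlim (fun m => ?_)
    (fun m => ?_)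
  · exact Finset.sum_nonneg fun j _ => mul_nonneg (pow_nonneg ha.1.le _) (pow_nonneg h1 _)
  · have hle : ∀ j ∈ Finset.range (m + 1), a ^ j * (1 - a) ^ (m - j) ≤ M ^ m := by
      intro j hj
      have hj : j ≤ m := Nat.lt_succ_iff.1 (Finset.mem_range.1 hj)
      calc a ^ j * (1 - a) ^ (m - j) ≤ M ^ j * M ^ (m - j) :=
            mul_le_mul (pow_le_pow_left₀ ha.1.le (le_max_left _ _) _)
              (pow_le_pow_left₀ h1 (le_max_right _ _) _) (pow_nonneg h1 _) (pow_nonneg hM0 _)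
        _ = M ^ m := by rw [← pow_add, Nat.add_sub_cancel' hj]
    refine (Finset.sum_le_sum hle).trans_eq ?_
    simp
    ring

/-- `B` occurs in a long block as often as in its constituents of level `m`, up to the junctions. -/
theorem freq_bounds (B : List Letter) {m n k : ℕ} (hm : 1 ≤ m) (hn : m ≤ n) (hk : m ≤ k) :
    ∑ j ∈ Finset.range (m + 1), ((n - m).choose (k - j) : ℝ) / (n.choose k : ℝ) *
        (occurrences B (basicBlock m j) : ℝ) ≤ freq B (basicBlock n k) ∧
      freq B (basicBlock n k) ≤ ∑ j ∈ Finset.range (m + 1),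
        ((n - m).choose (k - j) : ℝ) / (n.choose k : ℝ) *
          ((occurrences B (basicBlock m j) : ℝ) + B.length) := by
  rw [freq, length_basicBlock (hm.trans hn)]
  simp only [div_mul_eq_mul_div, ← Finset.sum_div]
  constructor
  · gcongr
    exact_mod_cast sum_occurrences_le B hm hn hk
  · gcongr
    exact_mod_cast occurrences_le_sum B hm hn hk

end PascalAdic

theorem theorem4p5 (B : List PascalAdic.Letter) (hB : B ∈ PascalAdic.language)
    (α : ℝ) (hα : α ∈ Set.Ioo (0 : ℝ) 1)
    (k : ℕ → ℕ) (hk : Tendsto (fun n : ℕ => (k n : ℝ) / (n : ℝ)) atTop (𝓝 α)) :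
    Tendsto (fun n : ℕ => PascalAdic.freq B (PascalAdic.basicBlock n (k n))) atTop
      (𝓝 ((PascalAdic.nu ⟨α, Set.Ioo_subset_Icc_self hα⟩).real (PascalAdic.cylinder B))) := by
  have hweights := PascalAdic.tendsto_sum_weights_zero hα
  rw [Metric.tendsto_nhds]
  intro ε hε
  -- a level `m` at which the lower and the upper bound differ by less than `ε / 2`
  have hsmall := (hweights.const_mul (B.length : ℝ)).eventually
    (gt_mem_nhds (by simpa using half_pos hε : (B.length : ℝ) * 0 < ε / 2))
  obtain ⟨m, hmε, hm⟩ := (hsmall.and (eventually_ge_atTop 1)).exists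
  have hν1 := PascalAdic.sum_occurrences_le_nu ⟨α, Set.Ioo_subset_Icc_self hα⟩ hα B hm
  have hν2 := PascalAdic.nu_le_sum_occurrences_add ⟨α, Set.Ioo_subset_Icc_self hα⟩ hα B hm
  have hlim : ∀ v : ℕ → ℝ, Tendsto (fun n => ∑ j ∈ Finset.range (m + 1),
      ((n - m).choose (k n - j) : ℝ) / (n.choose (k n) : ℝ) * v j) atTop
      (𝓝 (∑ j ∈ Finset.range (m + 1), α ^ j * (1 - α) ^ (m - j) * v j)) := fun v =>
    tendsto_finsetSum _ fun j hj => (PascalAdic.tendsto_choose_ratio hα hk m j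
      (Nat.lt_succ_iff.1 (Finset.mem_range.1 hj))).mul_const _
  have hlow := (hlim fun j => (PascalAdic.occurrences B (PascalAdic.basicBlock m j) : ℝ)).eventually
    (lt_mem_nhds (sub_lt_self _ (half_pos hε)))
  have hup := (hlim fun j => (PascalAdic.occurrences B (PascalAdic.basicBlock m j) : ℝ) +
    B.length).eventually (gt_mem_nhds (lt_add_of_pos_right _ (half_pos hε)))
  filter_upwards [hlow, hup, eventually_ge_atTop m,
    PascalAdic.eventually_le_of_tendsto_div hα.1 hk m] with n h1 h2 hn hkn
  obtain ⟨h3, h4⟩ := PascalAdic.freq_bounds B hm hn hkn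
  simp only [mul_add, Finset.sum_add_distrib, ← Finset.sum_mul] at h2 h4 hν2
  rw [Real.dist_eq, abs_lt]
  constructor <;> linarith
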